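/- Let $d$ be a dimension, let $B=\{x\in\mathbb{R}^d:\|x\|\le 1\}$ be the closed Euclidean unit ball and $\stackrel{\circ}{B}$ its interior, and let $Q>0$. For a random variable $U$ with values in $B$, $p>0$ and $y\in\stackrel{\circ}{B}$ put $$T_p(U)(y)=\mathbb{E}\left(\frac{1}{(1+\langle y,U\rangle)^{p}}\right).$$ A random variable $W$ with values in $B$ and law $\mu$ is called *Dirichlet infinitely divisible of type $Q$* if for every integer $n\ge 1$ there exists a probability measure $\nu_n$ on $B$ such that, whenever $Y=(Y_1,\ldots,Y_n)$ has the Dirichlet distribution $\mathcal{D}(Q/n,\ldots,Q/n)$ and, independently of $Y$, $W_1,\ldots,W_n$ are i.i.d. with law $\nu_n$, the random variable $Y_1W_1+\cdots+Y_nW_n$ has law $\mu$. (The Dirichlet distribution $\mathcal{D}(q_1,\ldots,q_n)$ with $q_i>0$ is the law of $(G_1,\ldots,G_n)/(G_1+\cdots+G_n)$ where $G_1,\ldots,G_n$ are independent and $G_i$ is gamma distributed with shape $q_i$ and scale $1$.) Let $W$ be a random variable with values in $B$. Then the following three properties are equivalent: 1. $W$ is Dirichlet infinitely divisible of type $Q$;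 2. for every integer $n\ge 1$ there exists a random variable $\tilde W^{(n)}$ with values in $B$ such that for all $y\in\stackrel{\circ}{B}$ $$T_Q(W)(y)=\left[T_{Q/n}(\tilde W^{(n)})(y)\right]^n;$$ 3. there exists a random variable $\hat W$ with values in $B$ such that for all $y\in\stackrel{\circ}{B}$ $$T_Q(W)(y)=e^{-Q\,\mathbb{E}\left(\log(1+\langle y,\hat W\rangle)\right)}.$$ -/

import Mathlib

open MeasureTheory ProbabilityTheory

noncomputable section

/-- The Dirichlet distribution with parameters `q 0, …, q (n-1)` (positive, `n ≥ 1`), as a probability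
measure on `ℝⁿ`: the law of `(G₁ / S, …, Gₙ / S)` where `G₁, …, Gₙ` are independent, `Gᵢ` is gamma
distributed with shape `qᵢ` and scale `1`, and `S = G₁ + ⋯ + Gₙ`. -/
def dirichletMeasure {n : ℕ} (q : Fin n → ℝ) : Measure (Fin n → ℝ) :=
  (Measure.pi fun i => gammaMeasure (q i) 1).map fun g i => g i / ∑ j, g j

/-- `U` is a random variable on the probability space `(Ω, P)` with values in the closed unit ball
of the Euclidean space of dimension `d`. -/
structure IsUnitBallRV {d : ℕ} {Ω : Type*} [MeasurableSpace Ω]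
    (U : Ω → EuclideanSpace ℝ (Fin d)) (P : Measure Ω) : Prop where
  isProbabilityMeasure : IsProbabilityMeasure P
  aemeasurable : AEMeasurable U P
  mem_ball : ∀ᵐ ω ∂P, U ω ∈ Metric.closedBall (0 : EuclideanSpace ℝ (Fin d)) 1

/-- The transform `T_p(U)(y) = E((1 + ⟨y, U⟩)^(-p))`. For `U` in the closed unit ball and
`‖y‖ < 1` the integrand is a.s. at most `(1 - ‖y‖)^(-p)`. -/
def stieltjesT {d : ℕ} {Ω : Type*} [MeasurableSpace Ω] (p : ℝ)
    (U : Ω → EuclideanSpace ℝ (Fin d)) (P : Measure Ω) (y : EuclideanSpace ℝ (Fin d)) : ℝ :=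
  ∫ ω, 1 / (1 + inner ℝ y (U ω)) ^ p ∂P

/-- The law of `Y₁ W₁ + ⋯ + Yₙ Wₙ` where `Y ∼ 𝒟(q₁, …, qₙ)` and, independently of `Y`, the vectors
`W₁, …, Wₙ` are i.i.d. with law `ν`. -/
def dirichletMixture {d n : ℕ} (q : Fin n → ℝ) (ν : Measure (EuclideanSpace ℝ (Fin d))) :
    Measure (EuclideanSpace ℝ (Fin d)) :=
  ((dirichletMeasure q).prod (Measure.pi fun _ : Fin n => ν)).map
    fun z => ∑ i, z.1 i • z.2 i

/-- A law `μ` on the unit ball is Dirichlet infinitely divisible of type `Q` if for all `n ≥ 1` there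
is a probability measure `ν` on the closed unit ball such that `Y₁ W₁ + ⋯ + Yₙ Wₙ ∼ μ` when
`Y ∼ 𝒟(Q/n, …, Q/n)` and, independently, `W₁, …, Wₙ` are i.i.d. with law `ν`. -/
def IsDirichletInfinitelyDivisible {d : ℕ} (Q : ℝ)
    (μ : Measure (EuclideanSpace ℝ (Fin d))) : Prop :=
  ∀ n : ℕ, 1 ≤ n → ∃ ν : Measure (EuclideanSpace ℝ (Fin d)),
    IsProbabilityMeasure ν ∧ (∀ᵐ w ∂ν, w ∈ Metric.closedBall 0 1) ∧
      dirichletMixture (fun _ : Fin n => Q / n) ν = μ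

end

/-! ### Gamma laws: scaling, Laplace transforms and gamma integrals on the half-line. -/

section Gamma

/-! If `Y` is Dirichlet with parameters `q i` of sum `Q`, then `E ⟨Y, a⟩ ^ (-Q) = ∏ a i ^ (-q i)`
for positive `a` (`lintegral_dirichletMeasure`). As the weights sum to 1, taking `a i = 1 + ⟨y, W
i⟩` shows that `T_Q` of a Dirichlet mixture of `ν` with weights `Q/n` is `T_{Q/n}(ν) ^ n`. With
injectivity of `T_Q` on laws of the ball (`eq_of_stieltjesT_eq`), this makes 1 and 2 equivalent.

The link with 3 is the expansion `T_{Q/n}(ν)(y) = 1 - (Q/n) E log (1 + ⟨y, ·⟩) + O(1/n²)`, uniform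
in `ν`, whose `n`-th power tends to an exponential (`tendsto_stieltjesT_pow`). From 2 to 3, a limit
point of the laws of the `n`-th roots is the required law, since laws on a compact ball form a
compact set. From 3 to 2, with `α` the law of `Ŵ` and `q = Q/n`, a limit point of the mixtures of
`α` with `m` weights `q/m` has transform `exp (-q E log (1 + ⟨y, Ŵ⟩))`, which is the `n`-th root
sought (`exists_stieltjesT_eq_exp`). -/

/-- The integral of a product of functions of independent coordinates. -/
theorem lintegral_pi_prod {ι : Type*} [Fintype ι] {α : ι → Type*} [∀ i, MeasurableSpace (α i)]
    (μ : ∀ i, Measure (α i)) [∀ i, IsProbabilityMeasure (μ i)] {f : ∀ i, α i → ENNReal}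
    (hf : ∀ i, Measurable (f i)) :
    ∫⁻ x, ∏ i, f i (x i) ∂Measure.pi μ = ∏ i, ∫⁻ x, f i x ∂μ i := by
  have hind : iIndepFun (fun i (x : ∀ i, α i) => f i (x i)) (Measure.pi μ) :=
    iIndepFun_pi fun i => (hf i).aemeasurable
  rw [lintegral_prod_eq_prod_lintegral_of_indepFun _ _ hind
    fun i => (hf i).comp (measurable_pi_apply i)]
  refine Finset.prod_congr rfl fun i _ => ?_
  rw [← (measurePreserving_eval μ i).lintegral_comp (hf i)]

theorem pi_withDensity {ι : Type*} [Fintype ι] {α : ι → Type*} [∀ i, MeasurableSpace (α i)]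
    (μ : ∀ i, Measure (α i)) [∀ i, IsProbabilityMeasure (μ i)] {f : ∀ i, α i → ENNReal}
    (hf : ∀ i, Measurable (f i)) [∀ i, SigmaFinite ((μ i).withDensity (f i))] :
    Measure.pi (fun i => (μ i).withDensity (f i)) =
      (Measure.pi μ).withDensity fun x => ∏ i, f i (x i) := by
  refine Measure.pi_eq fun s hs => ?_
  rw [withDensity_apply _ (MeasurableSet.univ_pi hs),
    ← lintegral_indicator (MeasurableSet.univ_pi hs)]
  have h : ∀ x : ∀ i, α i, (Set.univ.pi s).indicator (fun x => ∏ i, f i (x i)) x =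
      ∏ i, (s i).indicator (f i) (x i) := by
    intro x
    by_cases hx : x ∈ Set.univ.pi s
    · rw [Set.indicator_of_mem hx]
      exact Finset.prod_congr rfl fun i _ =>
        (Set.indicator_of_mem (hx i (Set.mem_univ i)) _).symm
    · rw [Set.indicator_of_notMem hx]
      simp only [Set.mem_univ_pi, not_forall] at hx
      obtain ⟨i, hi⟩ := hx
      exact (Finset.prod_eq_zero (Finset.mem_univ i) (Set.indicator_of_notMem hi _)).symm
  simp_rw [h]
  rw [lintegral_pi_prod μ fun i => (hf i).indicator (hs i)]
  exact Finset.prod_congr rfl fun i _ => by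
    rw [lintegral_indicator (hs i), withDensity_apply _ (hs i)]

theorem measurable_gammaPDF (a r : ℝ) : Measurable (gammaPDF a r) :=
  (measurable_gammaPDFReal a r).ennreal_ofReal

theorem lintegral_comp_mul_left_real {u : ℝ} (hu : 0 < u) {f : ℝ → ENNReal} (hf : Measurable f) :
    ∫⁻ x, f (u * x) = ENNReal.ofReal u⁻¹ * ∫⁻ x, f x := by
  rw [← lintegral_map hf (measurable_const_mul u), Real.map_volume_mul_left hu.ne',
    lintegral_smul_measure, abs_of_pos (inv_pos.2 hu), smul_eq_mul]

/-- Scaling a gamma variable by `u` amounts to tilting its law exponentially. -/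
theorem map_mul_gammaMeasure {q u : ℝ} (hq : 0 < q) (hu : 0 < u) :
    (gammaMeasure q 1).map (fun x => u * x) = (gammaMeasure q 1).withDensity
      fun x => ENNReal.ofReal (u ^ (-q) * Real.exp (-(u⁻¹ - 1) * x)) := by
  refine Measure.ext_of_lintegral _ fun f hf => ?_
  have hd : Measurable fun x : ℝ => ENNReal.ofReal (u ^ (-q) * Real.exp (-(u⁻¹ - 1) * x)) := by
    fun_prop
  have hp := measurable_gammaPDF q 1
  have hfu : Measurable fun x => f (u * x) := hf.comp (measurable_const_mul u)
  rw [lintegral_map hf (measurable_const_mul u),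
    lintegral_withDensity_eq_lintegral_mul _ hd hf, gammaMeasure,
    lintegral_withDensity_eq_lintegral_mul _ hp hfu,
    lintegral_withDensity_eq_lintegral_mul _ hp (hd.mul hf)]
  have h1 : ∫⁻ x, (gammaPDF q 1 * fun x => f (u * x)) x =
      ∫⁻ x, (fun z => gammaPDF q 1 (u⁻¹ * z) * f z) (u * x) := by
    refine lintegral_congr fun x => ?_
    simp [hu.ne']
  have hm : Measurable fun z => gammaPDF q 1 (u⁻¹ * z) * f z :=
    (hp.comp (measurable_const_mul _)).mul hf
  rw [h1, lintegral_comp_mul_left_real hu hm, ← lintegral_const_mul _ hm]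
  refine lintegral_congr fun x => ?_
  simp only [Pi.mul_apply]
  rw [← mul_assoc, ← mul_assoc]
  congr 1
  rcases lt_or_ge x 0 with hx | hx
  · rw [gammaPDF_of_neg hx, gammaPDF_of_neg (mul_neg_of_pos_of_neg (inv_pos.2 hu) hx)]
    simp
  · have hu' := inv_pos.2 hu
    have hG := Real.Gamma_pos_of_pos hq
    rw [gammaPDF_of_nonneg hx, gammaPDF_of_nonneg (mul_nonneg hu'.le hx),
      ← ENNReal.ofReal_mul hu'.le, ← ENNReal.ofReal_mul (by positivity)]
    congr 1
    rw [Real.mul_rpow hu'.le hx, Real.rpow_sub_one hu'.ne', Real.inv_rpow hu.le,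
      Real.rpow_neg hu.le, show -(1 * x) = -(1 * (u⁻¹ * x)) - -(u⁻¹ - 1) * x by ring,
      Real.exp_sub]
    have := Real.exp_ne_zero (-(u⁻¹ - 1) * x)
    field_simp

/-- The Laplace transform of the gamma distribution. -/
theorem lintegral_exp_gammaMeasure {q a : ℝ} (hq : 0 < q) (ha : 0 < a) :
    ∫⁻ x, ENNReal.ofReal (Real.exp ((1 - a) * x)) ∂gammaMeasure q 1 =
      ENNReal.ofReal (a ^ (-q)) := by
  have hp := measurable_gammaPDF q 1
  rw [gammaMeasure, lintegral_withDensity_eq_lintegral_mul _ hp (by fun_prop)]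
  have h : ∀ x, (gammaPDF q 1 * fun x => ENNReal.ofReal (Real.exp ((1 - a) * x))) x =
      ENNReal.ofReal (a ^ (-q)) * gammaPDF q a x := by
    intro x
    rw [Pi.mul_apply]
    rcases lt_or_ge x 0 with hx | hx
    · simp [gammaPDF_of_neg hx]
    · have hG := Real.Gamma_pos_of_pos hq
      rw [gammaPDF_of_nonneg hx, gammaPDF_of_nonneg hx, ← ENNReal.ofReal_mul (by positivity),
        ← ENNReal.ofReal_mul (by positivity)]
      congr 1
      rw [Real.rpow_neg ha.le, Real.one_rpow,
        show (1 - a) * x = -(a * x) - -(1 * x) by ring, Real.exp_sub]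
      have := Real.exp_ne_zero (-(1 * x))
      field_simp
  rw [lintegral_congr h, lintegral_const_mul _ (measurable_gammaPDF q a),
    lintegral_gammaPDF_eq_one hq ha, mul_one]

theorem ae_pos_gammaMeasure (q : ℝ) : ∀ᵐ x ∂gammaMeasure q 1, 0 < x := by
  rw [gammaMeasure, ae_withDensity_iff (measurable_gammaPDF q 1)]
  have h0 : ∀ᵐ x : ℝ, x ≠ 0 := by simp [ae_iff]
  filter_upwards [h0] with x hx h
  by_contra hneg
  exact h (gammaPDF_of_neg (lt_of_le_of_ne (not_lt.1 hneg) hx))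

/-- `∫ t > 0, t ^ (Q - 1) * exp (-t * A) / Γ(Q) = A ^ (-Q)`. -/
theorem lintegral_rpow_mul_exp_Ioi {Q A : ℝ} (hQ : 0 < Q) (hA : 0 < A) :
    ∫⁻ t in Set.Ioi (0 : ℝ), ENNReal.ofReal (t ^ (Q - 1) / Real.Gamma Q * Real.exp (-(t * A))) =
      ENNReal.ofReal (A ^ (-Q)) := by
  have hG := Real.Gamma_pos_of_pos hQ
  have h : ∀ t ∈ Set.Ioi (0 : ℝ),
      ENNReal.ofReal (t ^ (Q - 1) / Real.Gamma Q * Real.exp (-(t * A))) =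
      ENNReal.ofReal (A ^ (-Q)) * gammaPDF Q A t := by
    intro t ht
    rw [gammaPDF_of_nonneg (le_of_lt ht), ← ENNReal.ofReal_mul (by positivity)]
    congr 1
    rw [Real.rpow_neg hA.le, mul_comm t A]
    have := (Real.rpow_pos_of_pos hA Q).ne'
    field_simp
  rw [setLIntegral_congr_fun measurableSet_Ioi h,
    lintegral_const_mul _ (measurable_gammaPDF Q A)]
  have h1 : ∫⁻ t in Set.Ioi (0 : ℝ), gammaPDF Q A t = 1 := by
    rw [← lintegral_gammaPDF_eq_one hQ hA, setLIntegral_congr Ioi_ae_eq_Ici,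
      ← lintegral_indicator measurableSet_Ici]
    refine lintegral_congr fun t => ?_
    rcases lt_or_ge t 0 with ht | ht
    · rw [Set.indicator_of_notMem (by simpa using ht), gammaPDF_of_neg ht]
    · rw [Set.indicator_of_mem (by simpa using ht)]
  rw [h1, mul_one]

theorem lintegral_Ioi_inv (g : ℝ → ENNReal) :
    ∫⁻ t in Set.Ioi (0 : ℝ), g t =
      ∫⁻ t in Set.Ioi (0 : ℝ), ENNReal.ofReal ((t ^ 2)⁻¹) * g t⁻¹ := by
  have himg : (fun t : ℝ => t⁻¹) '' Set.Ioi 0 = Set.Ioi 0 := by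
    ext t
    refine ⟨?_, fun ht => ⟨t⁻¹, Set.mem_Ioi.2 (inv_pos.2 ht), inv_inv t⟩⟩
    rintro ⟨s, hs, rfl⟩
    exact Set.mem_Ioi.2 (inv_pos.2 hs)
  have h := lintegral_image_eq_lintegral_abs_deriv_mul (f := fun t : ℝ => t⁻¹)
    (f' := fun t => -(t ^ 2)⁻¹) measurableSet_Ioi
    (fun t ht => (hasDerivAt_inv (ne_of_gt ht)).hasDerivWithinAt)
    (fun a _ b _ hab => inv_injective hab) g
  rw [himg] at h
  rw [h]
  refine lintegral_congr fun t => ?_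
  rw [abs_neg, abs_of_nonneg (by positivity)]

/-- The substitution `t ↦ t⁻¹` reduces this to the usual gamma integral. It recovers `S ^ (-Q)` at
the end of the proof of `lintegral_dirichletMeasure`. -/
theorem lintegral_rpow_mul_exp_inv_Ioi {Q A : ℝ} (hQ : 0 < Q) (hA : 0 < A) :
    ∫⁻ t in Set.Ioi (0 : ℝ),
        ENNReal.ofReal (t ^ (-Q - 1) / Real.Gamma Q * Real.exp (-(t⁻¹ * A))) =
      ENNReal.ofReal (A ^ (-Q)) := by
  rw [← lintegral_rpow_mul_exp_Ioi hQ hA, lintegral_Ioi_inv fun t =>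
    ENNReal.ofReal (t ^ (Q - 1) / Real.Gamma Q * Real.exp (-(t * A)))]
  refine setLIntegral_congr_fun measurableSet_Ioi fun t (ht : 0 < t) => ?_
  rw [← ENNReal.ofReal_mul (by positivity)]
  congr 1
  rw [Real.inv_rpow ht.le, ← Real.rpow_neg ht.le, ← Real.rpow_natCast t 2, ← Real.rpow_neg ht.le,
    ← mul_assoc, mul_div_assoc', ← Real.rpow_add ht]
  congr 3
  push_cast
  ring

end Gamma

/-! ### The gamma-Dirichlet identity. -/

section Dirichlet

variable {n : ℕ} {q : Fin n → ℝ}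

theorem measurable_dirichletMap (n : ℕ) : Measurable fun (g : Fin n → ℝ) i => g i / ∑ j, g j := by
  fun_prop

theorem isProbabilityMeasure_pi_gammaMeasure (hq : ∀ i, 0 < q i) :
    IsProbabilityMeasure (Measure.pi fun i => gammaMeasure (q i) 1) := by
  have := fun i => isProbabilityMeasure_gammaMeasure (hq i) one_pos
  infer_instance

theorem isProbabilityMeasure_dirichletMeasure (hq : ∀ i, 0 < q i) :
    IsProbabilityMeasure (dirichletMeasure q) := by
  have := isProbabilityMeasure_pi_gammaMeasure hq
  exact Measure.isProbabilityMeasure_map (measurable_dirichletMap n).aemeasurable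

theorem ae_pos_pi_gammaMeasure (hq : ∀ i, 0 < q i) :
    ∀ᵐ g ∂Measure.pi fun i => gammaMeasure (q i) 1, ∀ i, 0 < g i := by
  have := fun i => isProbabilityMeasure_gammaMeasure (hq i) one_pos
  rw [ae_all_iff]
  exact fun i => (Measure.tendsto_eval_ae_ae (i := i)).eventually (ae_pos_gammaMeasure (q i))

theorem ae_dirichletMeasure (hn : 0 < n) (hq : ∀ i, 0 < q i) :
    ∀ᵐ y ∂dirichletMeasure q, (∀ i, 0 ≤ y i) ∧ ∑ i, y i = 1 := by
  have : Nonempty (Fin n) := ⟨⟨0, hn⟩⟩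
  have hs : MeasurableSet {y : Fin n → ℝ | (∀ i, 0 ≤ y i) ∧ ∑ i, y i = 1} := by measurability
  refine (ae_map_iff (measurable_dirichletMap n).aemeasurable hs).2 ?_
  filter_upwards [ae_pos_pi_gammaMeasure hq] with g hg
  have hS : 0 < ∑ j, g j := Finset.sum_pos (fun i _ => hg i) Finset.univ_nonempty
  refine ⟨fun i => div_nonneg (hg i).le hS.le, ?_⟩
  rw [← Finset.sum_div, div_self hS.ne']

/-- The one-dimensional tilts multiply to a density depending on `g` only through its sum. This
takes the place of the independence of the sum and the normalized vector. -/
theorem map_smul_pi_gammaMeasure (hq : ∀ i, 0 < q i) {u : ℝ} (hu : 0 < u) :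
    (Measure.pi fun i => gammaMeasure (q i) 1).map (fun g i => u * g i) =
      (Measure.pi fun i => gammaMeasure (q i) 1).withDensity fun g =>
        ENNReal.ofReal (u ^ (-∑ i, q i) * Real.exp (-(u⁻¹ - 1) * ∑ i, g i)) := by
  have := fun i => isProbabilityMeasure_gammaMeasure (hq i) one_pos
  have hp : ∀ i, IsProbabilityMeasure ((gammaMeasure (q i) 1).map fun x => u * x) := fun i =>
    Measure.isProbabilityMeasure_map (measurable_const_mul u).aemeasurable
  have hw : ∀ i, IsProbabilityMeasure ((gammaMeasure (q i) 1).withDensity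
      fun x => ENNReal.ofReal (u ^ (-q i) * Real.exp (-(u⁻¹ - 1) * x))) := fun i => by
    rw [← map_mul_gammaMeasure (hq i) hu]
    exact hp i
  rw [Measure.pi_map_pi (f := fun _ x => u * x) fun i => (measurable_const_mul u).aemeasurable]
  simp_rw [fun i => map_mul_gammaMeasure (hq i) hu]
  rw [pi_withDensity _ fun i => by fun_prop]
  congr 1
  ext g
  rw [← ENNReal.ofReal_prod_of_nonneg fun i _ => by positivity, Finset.prod_mul_distrib,
    ← Real.exp_sum, ← Finset.mul_sum, ← Finset.sum_neg_distrib, Real.rpow_sum_of_pos hu]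

/-- The gamma-Dirichlet identity `E ⟨Y, a⟩ ^ (-∑ qᵢ) = ∏ aᵢ ^ (-qᵢ)`. -/
theorem lintegral_dirichletMeasure (hn : 0 < n) (hq : ∀ i, 0 < q i) {a : Fin n → ℝ}
    (ha : ∀ i, 0 < a i) :
    ∫⁻ y, ENNReal.ofReal ((∑ i, y i * a i) ^ (-∑ i, q i)) ∂dirichletMeasure q =
      ∏ i, ENNReal.ofReal (a i ^ (-q i)) := by
  have : Nonempty (Fin n) := ⟨⟨0, hn⟩⟩
  have := fun i => isProbabilityMeasure_gammaMeasure (hq i) one_pos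
  have hQ : 0 < ∑ i, q i := Finset.sum_pos (fun i _ => hq i) Finset.univ_nonempty
  set Q := ∑ i, q i with hQdef
  have hG := Real.Gamma_pos_of_pos hQ
  set γ := Measure.pi fun i => gammaMeasure (q i) 1 with hγ
  set S : (Fin n → ℝ) → ℝ := fun g => ∑ i, g i with hS
  set A : (Fin n → ℝ) → ℝ := fun g => ∑ i, g i * a i with hA
  have hSm : Measurable S := by fun_prop
  have hAm : Measurable A := by fun_prop
  have hpos : ∀ᵐ g ∂γ, 0 < S g ∧ 0 < A g := by
    filter_upwards [ae_pos_pi_gammaMeasure hq] with g hg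
    exact ⟨Finset.sum_pos (fun i _ => hg i) Finset.univ_nonempty,
      Finset.sum_pos (fun i _ => mul_pos (hg i) (ha i)) Finset.univ_nonempty⟩
  -- Substitute `g ↦ t • g` under the gamma law, at the cost of the exponential tilt. The factor
  -- `exp (-(t * A))` becomes `exp (-A)`, and `t` then survives only in a power and in `exp (-S/t)`.
  have hstep : ∀ t ∈ Set.Ioi (0 : ℝ),
      ∫⁻ g, ENNReal.ofReal (S g ^ Q * (t ^ (Q - 1) / Real.Gamma Q * Real.exp (-(t * A g)))) ∂γ =
      ∫⁻ g, ENNReal.ofReal (S g ^ Q * Real.exp (S g - A g) *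
        (t ^ (-Q - 1) / Real.Gamma Q * Real.exp (-(t⁻¹ * S g)))) ∂γ := by
    intro t (ht : 0 < t)
    set h : (Fin n → ℝ) → ENNReal := fun x =>
      ENNReal.ofReal ((t⁻¹ * S x) ^ Q * (t ^ (Q - 1) / Real.Gamma Q * Real.exp (-A x))) with hh
    have hhm : Measurable h := by fun_prop
    have hmul : Measurable fun (g : Fin n → ℝ) i => t * g i := by fun_prop
    have h1 : ∀ g, ENNReal.ofReal
        (S g ^ Q * (t ^ (Q - 1) / Real.Gamma Q * Real.exp (-(t * A g)))) =
        h fun i => t * g i := by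
      intro g
      have hS' : S (fun i => t * g i) = t * S g := by simp [hS, Finset.mul_sum]
      have hA' : A (fun i => t * g i) = t * A g := by simp [hA, Finset.mul_sum, mul_assoc]
      simp only [hh, hS', hA', inv_mul_cancel_left₀ ht.ne']
    rw [lintegral_congr h1, ← lintegral_map hhm hmul, hγ, map_smul_pi_gammaMeasure hq ht, ← hγ,
      lintegral_withDensity_eq_lintegral_mul _ (by fun_prop) hhm]
    refine lintegral_congr_ae ?_
    filter_upwards [hpos] with g hg
    obtain ⟨hg1, hg2⟩ := hg
    simp only [Pi.mul_apply, hh]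
    rw [← ENNReal.ofReal_mul (by positivity)]
    congr 1
    -- In the exponent `-Q + (-Q + (Q - 1))`, one `-Q` comes from the tilt, the other from `(t⁻¹ *
    -- S) ^ Q`, and `Q - 1` from the gamma kernel.
    rw [← hQdef, Real.mul_rpow (by positivity) hg1.le, Real.inv_rpow ht.le, ← Real.rpow_neg ht.le,
      show (-Q - 1 : ℝ) = -Q + (-Q + (Q - 1)) by ring, Real.rpow_add ht, Real.rpow_add ht,
      show S g - A g = -(t⁻¹ - 1) * S g + -A g - -(t⁻¹ * S g) by ring, Real.exp_sub, Real.exp_add]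
    have := Real.exp_ne_zero (-(t⁻¹ * S g))
    field_simp
    simp only [hS]
  have hm1 : Measurable fun p : (Fin n → ℝ) × ℝ => ENNReal.ofReal
      (S p.1 ^ Q * (p.2 ^ (Q - 1) / Real.Gamma Q * Real.exp (-(p.2 * A p.1)))) := by fun_prop
  have hm2 : Measurable fun p : ℝ × (Fin n → ℝ) => ENNReal.ofReal
      (S p.2 ^ Q * Real.exp (S p.2 - A p.2) *
        (p.1 ^ (-Q - 1) / Real.Gamma Q * Real.exp (-(p.1⁻¹ * S p.2)))) := by fun_prop
  -- Write `A ^ (-Q)` as a gamma integral in `t`, rescale `g` for each fixed `t`, then integrate `t`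
  -- out again: this cancels `S ^ Q` and leaves `exp (S - A)`, a product over coordinates.
  calc ∫⁻ y, ENNReal.ofReal ((∑ i, y i * a i) ^ (-Q)) ∂dirichletMeasure q
      = ∫⁻ g, ENNReal.ofReal (S g ^ Q) * ENNReal.ofReal (A g ^ (-Q)) ∂γ := by
        rw [dirichletMeasure, lintegral_map (by fun_prop) (measurable_dirichletMap n)]
        refine lintegral_congr_ae ?_
        filter_upwards [hpos] with g hg
        have h : ∑ i, g i / (∑ j, g j) * a i = A g / S g := by
          simp only [hA, hS, Finset.sum_div]
          exact Finset.sum_congr rfl fun i _ => by ring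
        rw [h, ← ENNReal.ofReal_mul (Real.rpow_nonneg hg.1.le _), Real.div_rpow hg.2.le hg.1.le,
          Real.rpow_neg hg.1.le, div_inv_eq_mul, mul_comm]
    _ = ∫⁻ g, (∫⁻ t in Set.Ioi (0 : ℝ), ENNReal.ofReal
          (S g ^ Q * (t ^ (Q - 1) / Real.Gamma Q * Real.exp (-(t * A g))))) ∂γ := by
        refine lintegral_congr_ae ?_
        filter_upwards [hpos] with g hg
        simp_rw [ENNReal.ofReal_mul (Real.rpow_nonneg hg.1.le Q)]
        rw [lintegral_const_mul _ (by fun_prop), lintegral_rpow_mul_exp_Ioi hQ hg.2]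
    _ = ∫⁻ t in Set.Ioi (0 : ℝ), ∫⁻ g, ENNReal.ofReal
          (S g ^ Q * (t ^ (Q - 1) / Real.Gamma Q * Real.exp (-(t * A g)))) ∂γ :=
        lintegral_lintegral_swap hm1.aemeasurable
    _ = ∫⁻ t in Set.Ioi (0 : ℝ), ∫⁻ g, ENNReal.ofReal (S g ^ Q * Real.exp (S g - A g) *
          (t ^ (-Q - 1) / Real.Gamma Q * Real.exp (-(t⁻¹ * S g)))) ∂γ :=
        setLIntegral_congr_fun measurableSet_Ioi hstep
    _ = ∫⁻ g, (∫⁻ t in Set.Ioi (0 : ℝ), ENNReal.ofReal (S g ^ Q * Real.exp (S g - A g) *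
          (t ^ (-Q - 1) / Real.Gamma Q * Real.exp (-(t⁻¹ * S g))))) ∂γ :=
        lintegral_lintegral_swap hm2.aemeasurable
    _ = ∫⁻ g, ∏ i, ENNReal.ofReal (Real.exp ((1 - a i) * g i)) ∂γ := by
        refine lintegral_congr_ae ?_
        filter_upwards [hpos] with g hg
        have h0 : 0 ≤ S g ^ Q * Real.exp (S g - A g) :=
          mul_nonneg (Real.rpow_nonneg hg.1.le Q) (Real.exp_pos _).le
        simp_rw [ENNReal.ofReal_mul h0]
        rw [lintegral_const_mul _ (by fun_prop), lintegral_rpow_mul_exp_inv_Ioi hQ hg.1,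
          ← ENNReal.ofReal_mul h0, ← ENNReal.ofReal_prod_of_nonneg fun i _ => (Real.exp_pos _).le,
          ← Real.exp_sum]
        congr 1
        have h1 : ∑ i, (1 - a i) * g i = S g - A g := by
          simp only [hS, hA, ← Finset.sum_sub_distrib]
          exact Finset.sum_congr rfl fun i _ => by ring
        rw [h1, Real.rpow_neg hg.1.le]
        have := (Real.rpow_pos_of_pos hg.1 Q).ne'
        field_simp
    _ = ∏ i, ENNReal.ofReal (a i ^ (-q i)) := by
        rw [hγ, lintegral_pi_prod (f := fun i x => ENNReal.ofReal (Real.exp ((1 - a i) * x))) _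
          fun i => by fun_prop]
        exact Finset.prod_congr rfl fun i _ => lintegral_exp_gammaMeasure (hq i) (ha i)

end Dirichlet

/-! ### The transform of a Dirichlet mixture. -/

section Transform

variable {d : ℕ}

local notation "E" => EuclideanSpace ℝ (Fin d)

theorem abs_inner_le_norm_of_mem_closedBall {y x : E} (hx : x ∈ Metric.closedBall (0 : E) 1) :
    |inner ℝ y x| ≤ ‖y‖ := by
  rw [mem_closedBall_zero_iff] at hx
  calc |inner ℝ y x| ≤ ‖y‖ * ‖x‖ := abs_real_inner_le_norm y x
    _ ≤ ‖y‖ * 1 := by gcongr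
    _ = ‖y‖ := mul_one _

theorem one_add_inner_pos {y x : E} (hy : y ∈ Metric.ball (0 : E) 1)
    (hx : x ∈ Metric.closedBall (0 : E) 1) : 0 < 1 + inner ℝ y x := by
  rw [mem_ball_zero_iff] at hy
  have := (abs_le.1 (abs_inner_le_norm_of_mem_closedBall (y := y) hx)).1
  linarith

theorem IsUnitBallRV.map {Ω : Type*} [MeasurableSpace Ω] {U : Ω → E} {P : Measure Ω}
    (h : IsUnitBallRV U P) : IsUnitBallRV (id : E → E) (P.map U) where
  isProbabilityMeasure := by
    have := h.isProbabilityMeasure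
    exact Measure.isProbabilityMeasure_map h.aemeasurable
  aemeasurable := aemeasurable_id
  mem_ball := (ae_map_iff h.aemeasurable Metric.isClosed_closedBall.measurableSet).2 h.mem_ball

theorem stieltjesT_map {Ω : Type*} [MeasurableSpace Ω] {U : Ω → E} {P : Measure Ω}
    (h : AEMeasurable U P) (p : ℝ) (y : E) :
    stieltjesT p (id : E → E) (P.map U) y = stieltjesT p U P y := by
  have hm : Measurable fun x : E => 1 / (1 + inner ℝ y x) ^ p := by fun_prop
  exact integral_map h hm.aestronglyMeasurable

theorem stieltjesT_eq_toReal {μ : Measure E} (hμ : IsUnitBallRV id μ) (p : ℝ) {y : E}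
    (hy : y ∈ Metric.ball (0 : E) 1) :
    stieltjesT p id μ y = (∫⁻ x, ENNReal.ofReal ((1 + inner ℝ y x) ^ (-p)) ∂μ).toReal := by
  have h : stieltjesT p id μ y = ∫ x, (1 + inner ℝ y x) ^ (-p) ∂μ := by
    refine integral_congr_ae ?_
    filter_upwards [hμ.mem_ball] with x hx
    rw [id_eq] at hx ⊢
    rw [Real.rpow_neg (one_add_inner_pos hy hx).le, one_div]
  have hm : Measurable fun x : E => (1 + inner ℝ y x) ^ (-p) := by fun_prop
  rw [h, integral_eq_lintegral_of_nonneg_ae _ hm.aestronglyMeasurable]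
  filter_upwards [hμ.mem_ball] with x hx
  exact Real.rpow_nonneg (one_add_inner_pos hy hx).le _

theorem isUnitBallRV_dirichletMixture {n : ℕ} (hn : 0 < n) {q : Fin n → ℝ} (hq : ∀ i, 0 < q i)
    {ν : Measure E} (hν : IsUnitBallRV id ν) : IsUnitBallRV id (dirichletMixture q ν) := by
  have := hν.isProbabilityMeasure
  have := isProbabilityMeasure_dirichletMeasure hq
  have hm : Measurable fun z : (Fin n → ℝ) × (Fin n → E) => ∑ i, z.1 i • z.2 i := by fun_prop
  refine IsUnitBallRV.map ⟨inferInstance, hm.aemeasurable, ?_⟩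
  have h1 := (Measure.quasiMeasurePreserving_fst (μ := dirichletMeasure q)
    (ν := Measure.pi fun _ : Fin n => ν)).ae (ae_dirichletMeasure hn hq)
  have h2 : ∀ᵐ w ∂Measure.pi fun _ : Fin n => ν, ∀ i, w i ∈ Metric.closedBall (0 : E) 1 :=
    ae_all_iff.2 fun i => (Measure.tendsto_eval_ae_ae (i := i)).eventually hν.mem_ball
  have h3 := (Measure.quasiMeasurePreserving_snd (μ := dirichletMeasure q)
    (ν := Measure.pi fun _ : Fin n => ν)).ae h2
  filter_upwards [h1, h3] with z hz hw
  exact (convex_closedBall (0 : E) 1).sum_mem (fun i _ => hz.1 i) hz.2 fun i _ => hw i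

/-- For fixed `w`, the relation `∑ z i = 1` turns `1 + ⟨y, ∑ z i • w i⟩` into `∑ z i * (1 + ⟨y, w
i⟩)`, to which the gamma-Dirichlet identity applies; independence of the `w i` does the rest. -/
theorem stieltjesT_dirichletMixture {n : ℕ} (hn : 0 < n) {q : Fin n → ℝ} (hq : ∀ i, 0 < q i)
    {ν : Measure E} (hν : IsUnitBallRV id ν) {y : E} (hy : y ∈ Metric.ball (0 : E) 1) :
    stieltjesT (∑ i, q i) id (dirichletMixture q ν) y = ∏ i, stieltjesT (q i) id ν y := by
  have := hν.isProbabilityMeasure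
  have := isProbabilityMeasure_dirichletMeasure hq
  have hm : Measurable fun z : (Fin n → ℝ) × (Fin n → E) => ∑ i, z.1 i • z.2 i := by fun_prop
  have hf : Measurable fun x : E => ENNReal.ofReal ((1 + inner ℝ y x) ^ (-∑ i, q i)) := by
    fun_prop
  have hfm : Measurable fun z : (Fin n → ℝ) × (Fin n → E) =>
      ENNReal.ofReal ((1 + inner ℝ y (∑ i, z.1 i • z.2 i)) ^ (-∑ i, q i)) := hf.comp hm
  have h2 : ∀ᵐ w ∂Measure.pi fun _ : Fin n => ν, ∀ i, w i ∈ Metric.closedBall (0 : E) 1 :=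
    ae_all_iff.2 fun i => (Measure.tendsto_eval_ae_ae (i := i)).eventually hν.mem_ball
  rw [stieltjesT_eq_toReal (isUnitBallRV_dirichletMixture hn hq hν) _ hy, dirichletMixture,
    lintegral_map hf hm, lintegral_prod_symm _ hfm.aemeasurable]
  have h3 : ∀ᵐ w ∂Measure.pi fun _ : Fin n => ν,
      ∫⁻ z, ENNReal.ofReal ((1 + inner ℝ y (∑ i, z i • w i)) ^ (-∑ i, q i)) ∂dirichletMeasure q =
      ∏ i, ENNReal.ofReal ((1 + inner ℝ y (w i)) ^ (-q i)) := by
    filter_upwards [h2] with w hw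
    rw [← lintegral_dirichletMeasure hn hq fun i => one_add_inner_pos hy (hw i)]
    refine lintegral_congr_ae ?_
    filter_upwards [ae_dirichletMeasure hn hq] with z hz
    congr 2
    simp only [inner_sum, inner_smul_right, mul_add, mul_one, Finset.sum_add_distrib, hz.2]
  rw [lintegral_congr_ae h3, lintegral_pi_prod
    (f := fun i (x : E) => ENNReal.ofReal ((1 + inner ℝ y x) ^ (-q i))) _ fun i => by fun_prop,
    ENNReal.toReal_prod]
  exact Finset.prod_congr rfl fun i _ => (stieltjesT_eq_toReal hν _ hy).symm

theorem stieltjesT_dirichletMixture_const {n : ℕ} (hn : 1 ≤ n) {Q : ℝ} (hQ : 0 < Q)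
    {ν : Measure E} (hν : IsUnitBallRV id ν) {y : E} (hy : y ∈ Metric.ball (0 : E) 1) :
    stieltjesT Q id (dirichletMixture (fun _ : Fin n => Q / n) ν) y =
      stieltjesT (Q / n) id ν y ^ n := by
  have hn' : (0 : ℝ) < n := by exact_mod_cast hn
  have h := stieltjesT_dirichletMixture (q := fun _ : Fin n => Q / n) hn
    (fun _ => div_pos hQ hn') hν hy
  have hs : ∑ _i : Fin n, Q / n = Q := by
    simp only [Finset.sum_const, Finset.card_univ, Fintype.card_fin, nsmul_eq_mul]
    field_simp
  rw [hs] at h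
  simpa using h

end Transform

/-! ### Injectivity of the transform, through moments. -/

section Uniqueness

/-- Up to sign and `k!`, this is `Q (Q + 1) ⋯ (Q + k - 1) > 0`. It allows moments to be read off the
power series of `T_Q`. -/
theorem choose_neg_ne_zero {Q : ℝ} (hQ : 0 < Q) (k : ℕ) : Ring.choose (-Q) k ≠ 0 := by
  intro h
  rw [Ring.choose_neg', smul_eq_zero_iff_eq] at h
  have h1 := Ring.factorial_nsmul_multichoose_eq_ascPochhammer Q k
  rw [h, smul_zero, Polynomial.ascPochhammer_smeval_eq_eval] at h1
  exact (ascPochhammer_pos k Q hQ).ne h1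

theorem hasSum_one_add_rpow (a : ℝ) {z : ℝ} (hz : |z| < 1) :
    HasSum (fun k : ℕ => Ring.choose a k * z ^ k) ((1 + z) ^ a) := by
  have h := (Real.one_add_rpow_hasFPowerSeriesOnBall_zero (a := a)).hasSum (y := z)
    (by
      rw [Metric.mem_eball, edist_zero_right, ← ofReal_norm]
      simpa using ENNReal.ofReal_lt_one.2 hz)
  simpa [binomialSeries, mul_comm] using h

theorem summable_choose_mul_pow (a : ℝ) {r : ℝ} (hr : 0 ≤ r) (hr1 : r < 1) :
    Summable fun k : ℕ => |Ring.choose a k| * r ^ k := by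
  have h := (hasSum_one_add_rpow a (z := r) (by rwa [abs_of_nonneg hr])).summable.abs
  simpa [abs_mul, abs_of_nonneg hr] using h

variable {d : ℕ}

local notation "E" => EuclideanSpace ℝ (Fin d)

theorem integrable_inner_pow {μ : Measure E} (hμ : IsUnitBallRV id μ) (y : E) (k : ℕ) :
    Integrable (fun x => (inner ℝ y x) ^ k) μ := by
  have := hμ.isProbabilityMeasure
  have hm : Measurable fun x : E => (inner ℝ y x) ^ k := by fun_prop
  refine Integrable.of_bound hm.aestronglyMeasurable (‖y‖ ^ k) ?_
  filter_upwards [hμ.mem_ball] with x hx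
  rw [Real.norm_eq_abs, abs_pow]
  exact pow_le_pow_left₀ (abs_nonneg _) (abs_inner_le_norm_of_mem_closedBall hx) k

theorem integral_abs_inner_pow_le {μ : Measure E} (hμ : IsUnitBallRV id μ) (y : E) (k : ℕ) :
    ∫ x, |inner ℝ y x| ^ k ∂μ ≤ ‖y‖ ^ k := by
  have := hμ.isProbabilityMeasure
  have hi : Integrable (fun x => |inner ℝ y x| ^ k) μ := by
    simpa [abs_pow] using (integrable_inner_pow hμ y k).abs
  calc ∫ x, |inner ℝ y x| ^ k ∂μ ≤ ∫ _, ‖y‖ ^ k ∂μ := by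
        refine integral_mono_ae hi (integrable_const _) ?_
        filter_upwards [hμ.mem_ball] with x hx
        exact pow_le_pow_left₀ (abs_nonneg _) (abs_inner_le_norm_of_mem_closedBall hx) k
    _ = ‖y‖ ^ k := by simp

theorem hasSum_stieltjesT {μ : Measure E} (hμ : IsUnitBallRV id μ) (Q : ℝ) {y : E}
    (hy : y ∈ Metric.ball (0 : E) 1) :
    HasSum (fun k : ℕ => Ring.choose (-Q) k * ∫ x, (inner ℝ y x) ^ k ∂μ)
      (stieltjesT Q id μ y) := by
  have hy' : ‖y‖ < 1 := mem_ball_zero_iff.1 hy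
  have h := hasSum_integral_of_summable_integral_norm (μ := μ)
    (F := fun (k : ℕ) x => Ring.choose (-Q) k * (inner ℝ y x) ^ k)
    (fun k => (integrable_inner_pow hμ y k).const_mul _) (by
      refine Summable.of_nonneg_of_le (fun k => integral_nonneg fun x => norm_nonneg _)
        (fun k => ?_) (summable_choose_mul_pow (-Q) (norm_nonneg y) hy')
      simp only [norm_mul, Real.norm_eq_abs, abs_pow, integral_const_mul]
      gcongr
      exact integral_abs_inner_pow_le hμ y k)
  simp only [integral_const_mul] at h
  have he : stieltjesT Q id μ y = ∫ x, ∑' k : ℕ, Ring.choose (-Q) k * (inner ℝ y x) ^ k ∂μ := by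
    refine integral_congr_ae ?_
    filter_upwards [hμ.mem_ball] with x hx
    rw [id_eq] at hx ⊢
    rw [one_div, ← Real.rpow_neg (one_add_inner_pos hy hx).le]
    exact (hasSum_one_add_rpow (-Q)
      ((abs_inner_le_norm_of_mem_closedBall hx).trans_lt hy')).tsum_eq.symm
  rwa [he]

theorem hasFPowerSeriesAt_stieltjesT {μ : Measure E} (hμ : IsUnitBallRV id μ) (Q : ℝ) (y : E) :
    HasFPowerSeriesAt (fun t : ℝ => stieltjesT Q id μ (t • y))
      (FormalMultilinearSeries.ofScalars ℝ
        fun k => Ring.choose (-Q) k * ∫ x, (inner ℝ y x) ^ k ∂μ) 0 := by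
  rw [hasFPowerSeriesAt_iff]
  have hc : Continuous fun t : ℝ => t • y := by fun_prop
  have h : ∀ᶠ t : ℝ in nhds 0, t • y ∈ Metric.ball (0 : E) 1 :=
    hc.continuousAt.eventually_mem (Metric.isOpen_ball.mem_nhds (by simp))
  filter_upwards [h] with t ht
  rw [zero_add]
  have hk : ∀ k : ℕ, t ^ k • (FormalMultilinearSeries.ofScalars ℝ
      fun k => Ring.choose (-Q) k * ∫ x, (inner ℝ y x) ^ k ∂μ).coeff k =
      Ring.choose (-Q) k * ∫ x, (inner ℝ (t • y) x) ^ k ∂μ := by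
    intro k
    simp only [FormalMultilinearSeries.coeff_ofScalars, smul_eq_mul, inner_smul_left, mul_pow,
      integral_const_mul, conj_trivial]
    ring
  rw [funext hk]
  exact hasSum_stieltjesT hμ Q ht

/-- The transform `T_Q` determines the moments. -/
theorem integral_inner_pow_eq {μ ν : Measure E} (hμ : IsUnitBallRV id μ) (hν : IsUnitBallRV id ν)
    {Q : ℝ} (hQ : 0 < Q)
    (h : ∀ y ∈ Metric.ball (0 : E) 1, stieltjesT Q id μ y = stieltjesT Q id ν y)
    (y : E) (k : ℕ) : ∫ x, (inner ℝ y x) ^ k ∂μ = ∫ x, (inner ℝ y x) ^ k ∂ν := by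
  have hc : Continuous fun t : ℝ => t • y := by fun_prop
  have hb : ∀ᶠ t : ℝ in nhds 0, t • y ∈ Metric.ball (0 : E) 1 :=
    hc.continuousAt.eventually_mem (Metric.isOpen_ball.mem_nhds (by simp))
  have hμν : (fun t : ℝ => stieltjesT Q id ν (t • y)) =ᶠ[nhds 0]
      fun t => stieltjesT Q id μ (t • y) := by
    filter_upwards [hb] with t ht
    exact (h _ ht).symm
  -- Both transforms agree near 0 on the line through `y`, so their Taylor coefficients in `t`
  -- coincide.
  have h1 := (hasFPowerSeriesAt_stieltjesT hμ Q y).eq_formalMultilinearSeries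
    ((hasFPowerSeriesAt_stieltjesT hν Q y).congr hμν)
  have h2 := congrArg (fun p => FormalMultilinearSeries.coeff p k) h1
  simp only [FormalMultilinearSeries.coeff_ofScalars] at h2
  exact mul_left_cancel₀ (choose_neg_ne_zero hQ k) h2

/-- The moments are bounded by `‖y‖ ^ k`, so the exponential series integrates termwise for every
`y`; hence moments determine the law. -/
theorem hasSum_charFun {μ : Measure E} (hμ : IsUnitBallRV id μ) (y : E) :
    HasSum (fun k : ℕ => (Complex.I ^ k / k.factorial) * ((∫ x, (inner ℝ y x) ^ k ∂μ : ℝ) : ℂ))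
      (charFun μ y) := by
  have h := hasSum_integral_of_summable_integral_norm (μ := μ)
    (F := fun (k : ℕ) x => (Complex.I ^ k / k.factorial) * (((inner ℝ y x) ^ k : ℝ) : ℂ))
    (fun k => (integrable_inner_pow hμ y k).ofReal.const_mul _) (by
      refine Summable.of_nonneg_of_le (fun k => integral_nonneg fun x => norm_nonneg _)
        (fun k => ?_) (Real.summable_pow_div_factorial ‖y‖)
      simp only [norm_mul, norm_div, norm_pow, Complex.norm_I, one_pow, Complex.norm_real,
        Real.norm_eq_abs, Complex.norm_natCast, integral_const_mul]
      rw [one_div_mul_eq_div]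
      gcongr
      exact integral_abs_inner_pow_le hμ y k)
  simp only [integral_const_mul, integral_complex_ofReal] at h
  have he : charFun μ y =
      ∫ x, ∑' k : ℕ, (Complex.I ^ k / k.factorial) * (((inner ℝ y x) ^ k : ℝ) : ℂ) ∂μ := by
    rw [charFun_apply]
    refine integral_congr_ae (Filter.Eventually.of_forall fun x => ?_)
    dsimp only
    rw [real_inner_comm, Complex.exp_eq_exp_ℂ, NormedSpace.exp_eq_tsum_div]
    refine tsum_congr fun k => ?_
    rw [mul_pow]
    push_cast
    ring
  rwa [he]

/-- On laws carried by the unit ball, the transform `T_Q` is injective. -/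
theorem eq_of_stieltjesT_eq {μ ν : Measure E} (hμ : IsUnitBallRV id μ) (hν : IsUnitBallRV id ν)
    {Q : ℝ} (hQ : 0 < Q)
    (h : ∀ y ∈ Metric.ball (0 : E) 1, stieltjesT Q id μ y = stieltjesT Q id ν y) : μ = ν := by
  have := hμ.isProbabilityMeasure
  have := hν.isProbabilityMeasure
  refine Measure.ext_of_charFun (funext fun y => ?_)
  refine (hasSum_charFun hμ y).unique ?_
  simp_rw [integral_inner_pow_eq hμ hν hQ h y]
  exact hasSum_charFun hν y

end Uniqueness

/-! ### Limits of `n`-th powers and compactness of laws on the ball. -/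

section Limit

open Filter Topology

theorem tendsto_one_add_pow_of_le_atTop {l : Filter ℕ} (hl : l ≤ atTop) {g : ℕ → ℝ} {t : ℝ}
    (hg : Tendsto (fun n : ℕ => n * g n) l (𝓝 t)) :
    Tendsto (fun n => (1 + g n) ^ n) l (𝓝 (Real.exp t)) := by
  have hn : Tendsto (fun n : ℕ => ((n : ℝ))⁻¹) l (𝓝 0) :=
    (tendsto_inv_atTop_zero.comp tendsto_natCast_atTop_atTop).mono_left hl
  have hg0 : Tendsto g l (𝓝 0) := by
    have h := hn.mul hg
    rw [zero_mul] at h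
    refine h.congr' ?_
    filter_upwards [hl (eventually_ge_atTop 1)] with n hn1
    have : (n : ℝ) ≠ 0 := by positivity
    field_simp
  have h1 : Tendsto (fun n => 1 + g n) l (𝓝 1) := by simpa using hg0.const_add 1
  -- `dslope` extends `log z / (z - 1)` continuously to `z = 1`, so `n * log (1 + g n)` has the same
  -- limit as `n * g n`, even where `g n = 0`.
  have hd : Tendsto (fun n => dslope Real.log 1 (1 + g n)) l (𝓝 1) := by
    have hc : ContinuousAt (dslope Real.log 1) 1 :=
      continuousAt_dslope_same.2 (Real.differentiableAt_log one_ne_zero)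
    have h2 := hc.tendsto.comp h1
    rwa [dslope_same, Real.deriv_log, inv_one] at h2
  have h3 : Tendsto (fun n : ℕ => n * Real.log (1 + g n)) l (𝓝 t) := by
    have h4 := hg.mul hd
    rw [mul_one] at h4
    refine h4.congr fun n => ?_
    have h5 := sub_smul_dslope Real.log 1 (1 + g n)
    rw [Real.log_one, sub_zero, smul_eq_mul, add_sub_cancel_left] at h5
    rw [mul_assoc, h5]
  refine ((Real.continuous_exp.tendsto t).comp h3).congr' ?_
  filter_upwards [h1.eventually (lt_mem_nhds one_pos)] with n hpos
  rw [Function.comp_apply, mul_comm, ← Real.rpow_def_of_pos hpos, Real.rpow_natCast]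

variable {d : ℕ}

local notation "E" => EuclideanSpace ℝ (Fin d)

theorem abs_log_one_add_inner_le {x y : E} (hy : y ∈ Metric.ball (0 : E) 1)
    (hx : x ∈ Metric.closedBall (0 : E) 1) :
    |Real.log (1 + inner ℝ y x)| ≤ -Real.log (1 - ‖y‖) := by
  have hr : ‖y‖ < 1 := mem_ball_zero_iff.1 hy
  have hb := abs_le.1 (abs_inner_le_norm_of_mem_closedBall (y := y) hx)
  have hpos := one_add_inner_pos hy hx
  rw [abs_le, neg_neg]
  refine ⟨Real.log_le_log (by linarith) (by linarith), ?_⟩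
  rw [← Real.log_inv]
  refine Real.log_le_log hpos ?_
  rw [le_inv_comm₀ hpos (by linarith), inv_eq_one_div, le_div_iff₀ hpos]
  -- This rests on `(1 - ‖y‖) * (1 + ‖y‖) ≤ 1`.
  nlinarith [norm_nonneg y]

theorem integrable_log_one_add_inner {μ : Measure E} (hμ : IsUnitBallRV id μ) {y : E}
    (hy : y ∈ Metric.ball (0 : E) 1) : Integrable (fun x => Real.log (1 + inner ℝ y x)) μ := by
  have := hμ.isProbabilityMeasure
  have hm : Measurable fun x : E => Real.log (1 + inner ℝ y x) := by fun_prop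
  refine Integrable.of_bound hm.aestronglyMeasurable (-Real.log (1 - ‖y‖)) ?_
  filter_upwards [hμ.mem_ball] with x hx
  exact abs_log_one_add_inner_le hy hx

theorem stieltjesT_eq_integral_exp {μ : Measure E} (hμ : IsUnitBallRV id μ) (p : ℝ) {y : E}
    (hy : y ∈ Metric.ball (0 : E) 1) :
    stieltjesT p id μ y = ∫ x, Real.exp (-p * Real.log (1 + inner ℝ y x)) ∂μ := by
  refine integral_congr_ae ?_
  filter_upwards [hμ.mem_ball] with x hx
  rw [id_eq] at hx ⊢
  have hpos := one_add_inner_pos hy hx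
  rw [one_div, ← Real.rpow_neg hpos.le, Real.rpow_def_of_pos hpos, mul_comm]

theorem integrable_exp_log_one_add_inner {μ : Measure E} (hμ : IsUnitBallRV id μ) (p : ℝ) {y : E}
    (hy : y ∈ Metric.ball (0 : E) 1) :
    Integrable (fun x => Real.exp (-p * Real.log (1 + inner ℝ y x))) μ := by
  have := hμ.isProbabilityMeasure
  have hm : Measurable fun x : E => Real.exp (-p * Real.log (1 + inner ℝ y x)) := by fun_prop
  refine Integrable.of_bound hm.aestronglyMeasurable
    (Real.exp (|p| * -Real.log (1 - ‖y‖))) ?_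
  filter_upwards [hμ.mem_ball] with x hx
  rw [Real.norm_eq_abs, Real.abs_exp, Real.exp_le_exp]
  calc -p * Real.log (1 + inner ℝ y x) ≤ |-p * Real.log (1 + inner ℝ y x)| := le_abs_self _
    _ = |p| * |Real.log (1 + inner ℝ y x)| := by rw [abs_mul, abs_neg]
    _ ≤ |p| * -Real.log (1 - ‖y‖) := by
      gcongr
      exact abs_log_one_add_inner_le hy hx

/-- First-order expansion of the transform `T_p` at `p = 0`. -/
theorem abs_stieltjesT_sub_le {μ : Measure E} (hμ : IsUnitBallRV id μ) {p : ℝ} (hp : 0 ≤ p) {y : E}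
    (hy : y ∈ Metric.ball (0 : E) 1) (hp1 : p * -Real.log (1 - ‖y‖) ≤ 1) :
    |stieltjesT p id μ y - 1 + p * ∫ x, Real.log (1 + inner ℝ y x) ∂μ| ≤
      (p * -Real.log (1 - ‖y‖)) ^ 2 := by
  have := hμ.isProbabilityMeasure
  have hi := integrable_exp_log_one_add_inner hμ p hy
  have hl := (integrable_log_one_add_inner hμ hy).const_mul p
  have h1 : stieltjesT p id μ y - 1 + p * ∫ x, Real.log (1 + inner ℝ y x) ∂μ =
      ∫ x, (Real.exp (-p * Real.log (1 + inner ℝ y x)) - 1 +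
        p * Real.log (1 + inner ℝ y x)) ∂μ := by
    have hs : Integrable (fun x => Real.exp (-p * Real.log (1 + inner ℝ y x)) - 1) μ :=
      hi.sub (integrable_const 1)
    rw [integral_add hs hl, integral_sub hi (integrable_const 1),
      integral_const_mul, stieltjesT_eq_integral_exp hμ p hy]
    simp
  rw [h1, ← Real.norm_eq_abs]
  refine (norm_integral_le_of_norm_le_const (C := (p * -Real.log (1 - ‖y‖)) ^ 2) ?_).trans
    (by simp)
  filter_upwards [hμ.mem_ball] with x hx
  have hb : |-p * Real.log (1 + inner ℝ y x)| ≤ p * -Real.log (1 - ‖y‖) := by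
    rw [abs_mul, abs_neg, abs_of_nonneg hp]
    gcongr
    exact abs_log_one_add_inner_le hy hx
  have h2 := Real.abs_exp_sub_one_sub_id_le (hb.trans hp1)
  rw [neg_mul, sub_neg_eq_add] at h2
  rw [Real.norm_eq_abs, neg_mul]
  refine h2.trans ?_
  rw [← neg_mul, ← sq_abs]
  gcongr

theorem tendsto_stieltjesT_pow {l : Filter ℕ} (hl : l ≤ atTop) {ν : ℕ → Measure E}
    (hν : ∀ n, IsUnitBallRV id (ν n)) {q : ℝ} (hq : 0 < q) {y : E}
    (hy : y ∈ Metric.ball (0 : E) 1) {L : ℝ}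
    (hL : Tendsto (fun n => ∫ x, Real.log (1 + inner ℝ y x) ∂ν n) l (𝓝 L)) :
    Tendsto (fun n : ℕ => stieltjesT (q / n) id (ν n) y ^ n) l (𝓝 (Real.exp (-q * L))) := by
  set M := -Real.log (1 - ‖y‖)
  have hn : Tendsto (fun n : ℕ => (q * M) ^ 2 * ((n : ℝ))⁻¹) l (𝓝 0) := by
    simpa using ((tendsto_inv_atTop_zero.comp tendsto_natCast_atTop_atTop).mono_left
      hl).const_mul ((q * M) ^ 2)
  have h0 : Tendsto (fun n : ℕ => n * (stieltjesT (q / n) id (ν n) y - 1) +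
      q * ∫ x, Real.log (1 + inner ℝ y x) ∂ν n) l (𝓝 0) := by
    refine squeeze_zero_norm' ?_ hn
    -- Beyond `⌈q * M⌉₊` the exponents are at most 1 in absolute value, as the quadratic bound on
    -- `exp` requires.
    filter_upwards [hl (eventually_ge_atTop 1), hl (eventually_ge_atTop ⌈q * M⌉₊)] with n hn1 hn2
    have hnpos : (0 : ℝ) < n := by exact_mod_cast hn1
    have hle : q / n * M ≤ 1 := by
      rw [div_mul_eq_mul_div, div_le_one hnpos]
      exact (Nat.le_ceil _).trans (by exact_mod_cast hn2)
    have h := abs_stieltjesT_sub_le (hν n) (div_pos hq hnpos).le hy hle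
    have he : n * (stieltjesT (q / n) id (ν n) y - 1) +
        q * ∫ x, Real.log (1 + inner ℝ y x) ∂ν n =
        n * (stieltjesT (q / n) id (ν n) y - 1 +
          q / n * ∫ x, Real.log (1 + inner ℝ y x) ∂ν n) := by
      field_simp
    rw [he, Real.norm_eq_abs, abs_mul, abs_of_pos hnpos]
    calc n * |stieltjesT (q / n) id (ν n) y - 1 +
          q / n * ∫ x, Real.log (1 + inner ℝ y x) ∂ν n| ≤ n * (q / n * M) ^ 2 := by gcongr
      _ = (q * M) ^ 2 * ((n : ℝ))⁻¹ := by field_simp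
  have h1 := h0.sub (hL.const_mul q)
  rw [zero_sub, ← neg_mul] at h1
  refine (tendsto_one_add_pow_of_le_atTop hl (g := fun n => stieltjesT (q / n) id (ν n) y - 1)
    (h1.congr fun n => by ring)).congr fun n => by ring

/-- Sequential compactness (along an ultrafilter) of the laws carried by the closed unit ball. -/
theorem exists_tendsto_integral_hyperfilter {ν : ℕ → Measure E}
    (hν : ∀ n, IsUnitBallRV id (ν n)) :
    ∃ α : Measure E, IsUnitBallRV id α ∧
      ∀ f : E → ℝ, ContinuousOn f (Metric.closedBall 0 1) →
        Tendsto (fun n => ∫ x, f x ∂ν n) (hyperfilter ℕ) (𝓝 (∫ x, f x ∂α)) := by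
  -- The index is a dummy: a constant sequence of compacts with tail bound 0 puts "carried by the
  -- ball" in the form of the tightness criterion.
  set K : Set (ProbabilityMeasure E) := {μ | ∀ _ : ℕ, μ (Metric.closedBall (0 : E) 1)ᶜ ≤ 0}
  have hK : IsCompact K := isCompact_setOfPred_probabilityMeasure_mass_eq_compl_isCompact_le
    (u := fun _ => 0) tendsto_const_nhds (fun _ => isCompact_closedBall (0 : E) 1)
    (Or.inl inferInstance)
  have hball : ∀ μ : ProbabilityMeasure E, μ ∈ K ↔
      ∀ᵐ x ∂(μ : Measure E), x ∈ Metric.closedBall (0 : E) 1 := by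
    intro μ
    rw [ae_iff, ← ProbabilityMeasure.null_iff_toMeasure_null]
    simp [K, Set.compl_def]
  let N : ℕ → ProbabilityMeasure E := fun n => ⟨ν n, (hν n).isProbabilityMeasure⟩
  have hN : ∀ n, N n ∈ K := fun n => (hball _).2 (hν n).mem_ball
  obtain ⟨α, hα, hlim⟩ := hK.ultrafilter_le_nhds ((hyperfilter ℕ).map N)
    (by
      rw [Ultrafilter.coe_map, le_principal_iff, mem_map]
      exact Eventually.of_forall hN)
  have hαb := (hball α).1 hα
  refine ⟨α, ⟨inferInstance, aemeasurable_id, hαb⟩, fun f hf => ?_⟩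
  have hcl : IsClosed (Metric.closedBall (0 : E) 1) := Metric.isClosed_closedBall
  have : CompactSpace (Metric.closedBall (0 : E) 1) :=
    isCompact_iff_compactSpace.1 (isCompact_closedBall (0 : E) 1)
  let f₀ : BoundedContinuousFunction (Metric.closedBall (0 : E) 1) ℝ :=
    BoundedContinuousFunction.mkOfCompact ⟨_, continuousOn_iff_continuous_domRestrict.1 hf⟩
  -- Weak convergence tests bounded continuous functions on the whole space, so `f` is extended off
  -- the ball by Tietze.
  obtain ⟨g, -, hg⟩ := BoundedContinuousFunction.exists_extension_norm_eq_of_isClosedEmbedding f₀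
    hcl.isClosedEmbedding_subtypeVal
  have hgf : ∀ x ∈ Metric.closedBall (0 : E) 1, g x = f x := fun x hx =>
    congrFun hg ⟨x, hx⟩
  have hint : ∀ {μ : Measure E}, (∀ᵐ x ∂μ, x ∈ Metric.closedBall (0 : E) 1) →
      ∫ x, g x ∂μ = ∫ x, f x ∂μ := fun h => integral_congr_ae (h.mono hgf)
  have h := (ProbabilityMeasure.tendsto_iff_forall_integral_tendsto.1
    (show Tendsto N (hyperfilter ℕ) (𝓝 α) from hlim)) g
  rw [hint hαb] at h
  exact h.congr fun n => hint (hν n).mem_ball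

theorem continuousOn_log_one_add_inner {y : E} (hy : y ∈ Metric.ball (0 : E) 1) :
    ContinuousOn (fun x : E => Real.log (1 + inner ℝ y x)) (Metric.closedBall 0 1) :=
  ContinuousOn.log (by fun_prop) fun _ hx => (one_add_inner_pos hy hx).ne'

theorem continuousOn_one_div_one_add_inner_rpow {y : E} (hy : y ∈ Metric.ball (0 : E) 1) (p : ℝ) :
    ContinuousOn (fun x : E => 1 / (1 + inner ℝ y x) ^ p) (Metric.closedBall 0 1) :=
  ContinuousOn.div continuousOn_const
    (ContinuousOn.rpow_const (by fun_prop) fun _ hx => Or.inl (one_add_inner_pos hy hx).ne')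
    fun _ hx => (Real.rpow_pos_of_pos (one_add_inner_pos hy hx) p).ne'

/-- Existence of the mean of the Dirichlet process with parameter `q α`. -/
theorem exists_stieltjesT_eq_exp {α : Measure E} (hα : IsUnitBallRV id α) {q : ℝ} (hq : 0 < q) :
    ∃ μ : Measure E, IsUnitBallRV id μ ∧ ∀ y ∈ Metric.ball (0 : E) 1,
      stieltjesT q id μ y = Real.exp (-q * ∫ x, Real.log (1 + inner ℝ y x) ∂α) := by
  have hν : ∀ n : ℕ, ∃ ν : Measure E, IsUnitBallRV id ν ∧ (1 ≤ n →
      ∀ y ∈ Metric.ball (0 : E) 1, stieltjesT q id ν y = stieltjesT (q / n) id α y ^ n) := by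
    intro n
    rcases Nat.eq_zero_or_pos n with rfl | hn
    -- Any law on the ball serves as filler at `n = 0`, which the limit ignores.
    · exact ⟨α, hα, fun h => absurd h (by norm_num)⟩
    · exact ⟨_, isUnitBallRV_dirichletMixture hn
        (fun _ => div_pos hq (by exact_mod_cast hn)) hα,
        fun _ y hy => stieltjesT_dirichletMixture_const hn hq hα hy⟩
  choose ν hν hνT using hν
  obtain ⟨μ, hμ, hlim⟩ := exists_tendsto_integral_hyperfilter hν
  have hl : (hyperfilter ℕ : Filter ℕ) ≤ atTop := Nat.hyperfilter_le_atTop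
  refine ⟨μ, hμ, fun y hy => ?_⟩
  have h1 := hlim _ (continuousOn_one_div_one_add_inner_rpow hy q)
  have h2 := tendsto_stieltjesT_pow hl (fun _ => hα) hq hy (tendsto_const_nhds
    (x := ∫ x, Real.log (1 + inner ℝ y x) ∂α))
  refine tendsto_nhds_unique h1 (h2.congr' ?_)
  filter_upwards [hl (eventually_ge_atTop 1)] with n hn
  exact (hνT n hn y hy).symm

/-- A limit of `n`-th roots of a transform is of exponential form. -/
theorem exists_eq_exp_of_forall_pow {F : E → ℝ} {Q : ℝ} (hQ : 0 < Q)
    (h : ∀ n : ℕ, 1 ≤ n → ∃ ν : Measure E, IsUnitBallRV id ν ∧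
      ∀ y ∈ Metric.ball (0 : E) 1, F y = stieltjesT (Q / n) id ν y ^ n) :
    ∃ α : Measure E, IsUnitBallRV id α ∧ ∀ y ∈ Metric.ball (0 : E) 1,
      F y = Real.exp (-Q * ∫ x, Real.log (1 + inner ℝ y x) ∂α) := by
  have hν : ∀ n : ℕ, ∃ ν : Measure E, IsUnitBallRV id ν ∧ (1 ≤ n →
      ∀ y ∈ Metric.ball (0 : E) 1, F y = stieltjesT (Q / n) id ν y ^ n) := by
    intro n
    rcases Nat.eq_zero_or_pos n with rfl | hn
    · obtain ⟨ν, hν, -⟩ := h 1 le_rfl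
      exact ⟨ν, hν, fun h => absurd h (by norm_num)⟩
    · obtain ⟨ν, hν, hF⟩ := h n hn
      exact ⟨ν, hν, fun _ => hF⟩
  choose ν hν hνT using hν
  obtain ⟨α, hα, hlim⟩ := exists_tendsto_integral_hyperfilter hν
  have hl : (hyperfilter ℕ : Filter ℕ) ≤ atTop := Nat.hyperfilter_le_atTop
  refine ⟨α, hα, fun y hy => ?_⟩
  have h1 := tendsto_stieltjesT_pow hl hν hQ hy (hlim _ (continuousOn_log_one_add_inner hy))
  refine tendsto_nhds_unique (tendsto_const_nhds (f := (hyperfilter ℕ : Filter ℕ))) (h1.congr' ?_)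
  filter_upwards [hl (eventually_ge_atTop 1)] with n hn
  exact (hνT n hn y hy).symm

end Limit

theorem theorem17 {d : ℕ} {Ω : Type*} [MeasurableSpace Ω] (P : Measure Ω)
    (W : Ω → EuclideanSpace ℝ (Fin d)) (hW : IsUnitBallRV W P) (Q : ℝ) (hQ : 0 < Q) :
    List.TFAE [
      IsDirichletInfinitelyDivisible Q (P.map W),
      ∀ n : ℕ, 1 ≤ n →
        ∃ (Ω' : Type) (_ : MeasurableSpace Ω') (P' : Measure Ω')
          (W' : Ω' → EuclideanSpace ℝ (Fin d)), IsUnitBallRV W' P' ∧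
          ∀ y ∈ Metric.ball (0 : EuclideanSpace ℝ (Fin d)) 1,
            stieltjesT Q W P y = (stieltjesT (Q / n) W' P' y) ^ n,
      ∃ (Ω' : Type) (_ : MeasurableSpace Ω') (P' : Measure Ω')
        (W' : Ω' → EuclideanSpace ℝ (Fin d)), IsUnitBallRV W' P' ∧
        ∀ y ∈ Metric.ball (0 : EuclideanSpace ℝ (Fin d)) 1,
          stieltjesT Q W P y =
            Real.exp (-Q * ∫ ω, Real.log (1 + inner ℝ y (W' ω)) ∂P')] := by
  tfae_have 1 → 2 := by
    intro h n hn
    obtain ⟨ν, hν1, hν2, hν3⟩ := h n hn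
    have hν : IsUnitBallRV id ν := ⟨hν1, aemeasurable_id, hν2⟩
    refine ⟨_, _, ν, id, hν, fun y hy => ?_⟩
    rw [← stieltjesT_map hW.aemeasurable, ← hν3]
    exact stieltjesT_dirichletMixture_const hn hQ hν hy
  tfae_have 2 → 1 := by
    intro h n hn
    obtain ⟨Ω', _, P', W', hW', hT⟩ := h n hn
    refine ⟨P'.map W', hW'.map.isProbabilityMeasure, hW'.map.mem_ball, ?_⟩
    refine eq_of_stieltjesT_eq (isUnitBallRV_dirichletMixture hn
      (fun _ => div_pos hQ (by exact_mod_cast hn)) hW'.map) hW.map hQ fun y hy => ?_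
    rw [stieltjesT_dirichletMixture_const hn hQ hW'.map hy, stieltjesT_map hW'.aemeasurable,
      stieltjesT_map hW.aemeasurable, hT y hy]
  tfae_have 2 → 3 := by
    intro h
    obtain ⟨α, hα, hF⟩ := exists_eq_exp_of_forall_pow hQ (F := stieltjesT Q W P) fun n hn => by
      obtain ⟨Ω', _, P', W', hW', hT⟩ := h n hn
      exact ⟨P'.map W', hW'.map, fun y hy => by
        rw [hT y hy, stieltjesT_map hW'.aemeasurable]⟩
    exact ⟨_, _, α, id, hα, hF⟩
  tfae_have 3 → 2 := by
    rintro ⟨Ω', _, P', W', hW', hT⟩ n hn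
    have hn' : (0 : ℝ) < n := by exact_mod_cast hn
    obtain ⟨μ, hμ, hμT⟩ := exists_stieltjesT_eq_exp hW'.map (div_pos hQ hn')
    refine ⟨_, _, μ, id, hμ, fun y hy => ?_⟩
    have hm : Measurable fun x : EuclideanSpace ℝ (Fin d) => Real.log (1 + inner ℝ y x) := by
      fun_prop
    rw [hT y hy, hμT y hy, ← Real.exp_nat_mul,
      integral_map hW'.aemeasurable hm.aestronglyMeasurable]
    congr 1
    field_simp
  tfae_finish
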